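/- Let $\Gamma$ be a countable group. Let $\alpha$ be a p.m.p. (probability measure preserving) action $\Gamma\curvearrowright(X,\mu)$ on a standard Borel probability space and $\beta$ a p.m.p. action $\Gamma\curvearrowright(Y,\nu)$ on a probability space. Definitions. - *Factor.* $\alpha$ is a factor of $\beta$ if there is a measurable, measure preserving map $\theta:Y\to X$ (a factor map, or extension) with $\theta(\gamma y)=\gamma\theta(y)$ for all $\gamma\in\Gamma$ and almost every $y\in Y$. A factor map that is one-to-one on a conull set is an isomorphism. - *Weak containment.* $\alpha$ is weakly contained in $\beta$ if for every finite $S\subset\Gamma$, every finite measurable partition $\{A_i\}_{i=1}^n$ of $X$ and every $\varepsilon>0$ there is a measurable partition $\{B_i\}_{i=1}^n$ of $Y$ with $|\mu(\gamma A_i\cap A_j)-\nu(\gamma B_i\cap B_j)|<\varepsilon$ for all $\gamma\in S$ and $1\le i,j\le n$. - *Strong ergodicity.* $\beta$ is strongly ergodic if every sequence of measurable sets $A_n\subseteq Y$ with $\nu(\gamma A_n\triangle A_n)\to0$ for all $\gamma\in\Gamma$ satisfies $\nu(A_n)(1-\nu(A_n))\to0$. - *Compact extensions and actions.* A factor map $(X,\mu)\to(X_0,\mu_0)$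 of p.m.p. actions is a compact extension if there are a compact metrizable group $K$, a closed subgroup $L<K$ and a measurable cocycle $w:\Gamma\times X_0\to K$ such that $\Gamma\curvearrowright(X,\mu)$ is isomorphic to $(X_0\times K/L,\ \mu_0\otimes m_{K/L})$ with $\gamma(x,kL)=(\gamma x,w(\gamma,x)kL)$, the given factor map corresponding to the first projection; here $m_{K/L}$ is the unique $K$-invariant Borel probability measure on $K/L$. An ergodic action is compact if it is a compact extension of the one-point action. - *Largest intermediate compact extension.* Given a factor map $\varphi:X\to X_0$, an intermediate extension is a pair of factor maps $X\xrightarrow{\varphi_1}X_1\xrightarrow{\varphi_0}X_0$ with $\varphi_0\circ\varphi_1=\varphi$ a.e. It is the largest intermediate compact extension if $\varphi_0$ is compact and, for every other intermediate extension $X\xrightarrow{\psi_1}Z\xrightarrow{\psi_0}X_0$ ($Z$ standard) with $\psi_0$ compact, there is a factor map $\theta:X_1\to Z$ with $\theta\circ\varphi_1=\psi_1$ and $\psi_0\circ\theta=\varphi_0$ a.e. - *Measure distal actions.* The distal tower of an ergodic action $\alpha$ is the directed family $(\alpha_\zeta)_{\zeta<\omega_1}$ of factors of $\alpha$ (on standard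 probability spaces) such that $\alpha_0$ is the one-point action, $\alpha_{\zeta+1}$ is the largest intermediate compact extension of $\alpha_\zeta$ within $\alpha$, and for limit $\zeta$ the action $\alpha_\zeta$ is the inverse limit of $(\alpha_{\zeta'})_{\zeta'<\zeta}$. An ergodic action $\alpha$ is measure distal if $\alpha=\alpha_\zeta$ for some $\zeta<\omega_1$, i.e. the factor map from $\alpha$ to $\alpha_\zeta$ is an isomorphism. **Theorem.** Suppose that $\beta$ is strongly ergodic and that $\alpha$ is weakly contained in $\beta$. If $\alpha$ is measure distal, then $\alpha$ is a factor of $\beta$. In particular, if $\alpha$ is a compact action, then $\alpha$ is a factor of $\beta$. -/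

import Mathlib

open MeasureTheory Filter Topology
open scoped Pointwise symmDiff Ordinal

universe u v w

/-- A probability measure preserving (p.m.p.) action of `Γ` on a probability space.
Standardness of the underlying measurable space is stated separately where it is needed. -/
structure PMPAction (Γ : Type w) [Group Γ] : Type (max w (u + 1)) where
  carrier : Type u
  [measurableSpace : MeasurableSpace carrier]
  μ : Measure carrier
  [isProbabilityMeasure : IsProbabilityMeasure μ]
  [mulAction : MulAction Γ carrier]
  [measurableConstSMul : MeasurableConstSMul Γ carrier]
  [smulInvariantMeasure : SMulInvariantMeasure Γ carrier μ]

namespace PMPAction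

variable {Γ : Type w} [Group Γ]

instance : CoeSort (PMPAction.{u} Γ) (Type u) := ⟨carrier⟩

attribute [instance] measurableSpace isProbabilityMeasure mulAction measurableConstSMul
  smulInvariantMeasure

/-- The trivial action on a one-point probability space. -/
noncomputable def point (Γ : Type w) [Group Γ] : PMPAction.{u} Γ :=
  letI : MulAction Γ PUnit.{u + 1} :=
    { smul := fun _ x => x, one_smul := fun _ => rfl, mul_smul := fun _ _ _ => rfl }
  { carrier := PUnit.{u + 1}
    μ := Measure.dirac PUnit.unit
    measurableConstSMul := ⟨fun _ => measurable_id⟩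
    smulInvariantMeasure := ⟨fun _ _ _ => rfl⟩ }

/-- Ergodicity of a p.m.p. action. -/
def IsErgodic (α : PMPAction.{u} Γ) : Prop := ErgodicSMul Γ α α.μ

/-- Strong ergodicity: every asymptotically invariant sequence of measurable sets is trivial. -/
def IsStronglyErgodic (β : PMPAction.{u} Γ) : Prop :=
  ∀ A : ℕ → Set β, (∀ n, MeasurableSet (A n)) →
    (∀ γ : Γ, Tendsto (fun n => β.μ.real ((γ • A n) ∆ A n)) atTop (𝓝 0)) →
    Tendsto (fun n => β.μ.real (A n) * (1 - β.μ.real (A n))) atTop (𝓝 0)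

/-- `A` is a measurable partition of `X` into `n` (possibly empty) pieces. -/
structure IsMeasurablePartition {X : Type u} [MeasurableSpace X] {n : ℕ}
    (A : Fin n → Set X) : Prop where
  measurableSet : ∀ i, MeasurableSet (A i)
  disjoint : Pairwise fun i j => Disjoint (A i) (A j)
  iUnion_eq : ⋃ i, A i = Set.univ

/-- Weak containment `α ≺ β`. -/
def WeaklyContained (α : PMPAction.{u} Γ) (β : PMPAction.{v} Γ) : Prop :=
  ∀ (S : Finset Γ) (n : ℕ) (A : Fin n → Set α), IsMeasurablePartition A →
    ∀ ε : ℝ, 0 < ε → ∃ B : Fin n → Set β, IsMeasurablePartition B ∧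
      ∀ γ ∈ S, ∀ i j, |α.μ.real ((γ • A i) ∩ A j) - β.μ.real ((γ • B i) ∩ B j)| < ε

/-- `θ` is a factor map (extension) from `β` onto `α`. -/
structure IsFactorMap (β : PMPAction.{v} Γ) (α : PMPAction.{u} Γ) (θ : β → α) : Prop where
  measurePreserving : MeasurePreserving θ β.μ α.μ
  equivariant : ∀ γ : Γ, ∀ᵐ y ∂β.μ, θ (γ • y) = γ • θ y

/-- `α` is a factor of `β`. -/
def IsFactorOf (α : PMPAction.{u} Γ) (β : PMPAction.{v} Γ) : Prop :=
  ∃ θ : β → α, IsFactorMap β α θ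

/-- `θ` is one-to-one on a conull set. -/
def AEInjective {X : Type u} {Y : Type v} [MeasurableSpace X] (μ : Measure X) (θ : X → Y) : Prop :=
  ∃ s : Set X, (∀ᵐ x ∂μ, x ∈ s) ∧ Set.InjOn θ s

/-- The factor map `φ` from `α` to `α₀` is a compact (isometric) extension: it is isomorphic, over
`α₀`, to the skew product of `α₀` with a homogeneous space `K ⧸ L` of a compact metrizable group,
`γ (x, kL) = (γ x, w(γ, x) k L)`, given by a measurable cocycle `w`. The measure `m` is the unique
`K`-invariant Borel probability measure on `K ⧸ L`. -/
def IsCompactExtension (α α₀ : PMPAction.{u} Γ) (φ : α → α₀) : Prop :=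
  IsFactorMap α α₀ φ ∧
  ∃ (K : Type) (_ : Group K) (_ : TopologicalSpace K) (_ : IsTopologicalGroup K)
    (_ : CompactSpace K) (_ : TopologicalSpace.MetrizableSpace K)
    (_ : MeasurableSpace K) (_ : BorelSpace K)
    (L : Subgroup K) (m : Measure (K ⧸ L)) (w : Γ → α₀ → K) (Ψ : α → α₀ × (K ⧸ L)),
    IsClosed (L : Set K) ∧
    IsProbabilityMeasure m ∧
    (∀ k : K, m.map (fun q => k • q) = m) ∧
    (∀ γ, Measurable (w γ)) ∧
    (∀ γ δ : Γ, ∀ᵐ x ∂α₀.μ, w (γ * δ) x = w γ (δ • x) * w δ x) ∧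
    MeasurePreserving Ψ α.μ (α₀.μ.prod m) ∧
    (∀ γ : Γ, ∀ᵐ x ∂α.μ, Ψ (γ • x) = (γ • (Ψ x).1, w γ (Ψ x).1 • (Ψ x).2)) ∧
    AEInjective α.μ Ψ ∧
    (∀ᵐ x ∂α.μ, (Ψ x).1 = φ x)

/-- A compact action: an ergodic action that is a compact extension of the one-point action. -/
def IsCompactAction (α : PMPAction.{u} Γ) : Prop :=
  α.IsErgodic ∧ IsCompactExtension α (point.{u} Γ) (fun _ => PUnit.unit)

/-- `α → α₁ → α₀` (via `φ₁`, `φ₀`) is an intermediate extension of `α₀` within `α`, the latter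
being an extension of `α₀` through `φ`. -/
structure IsIntermediateExtension (α α₁ α₀ : PMPAction.{u} Γ) (φ : α → α₀)
    (φ₁ : α → α₁) (φ₀ : α₁ → α₀) : Prop where
  upper : IsFactorMap α α₁ φ₁
  lower : IsFactorMap α₁ α₀ φ₀
  comp_eq : ∀ᵐ x ∂α.μ, φ₀ (φ₁ x) = φ x

/-- `α → α₁ → α₀` is the largest intermediate compact extension of `α₀` within `α`, among
actions on standard probability spaces. -/
structure IsLargestCompactExtension (α α₁ α₀ : PMPAction.{u} Γ) (φ : α → α₀)
    (φ₁ : α → α₁) (φ₀ : α₁ → α₀) : Prop where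
  intermediate : IsIntermediateExtension α α₁ α₀ φ φ₁ φ₀
  compact : IsCompactExtension α₁ α₀ φ₀
  largest : ∀ (δ : PMPAction.{u} Γ) (_ : StandardBorelSpace δ) (ψ₁ : α → δ) (ψ₀ : δ → α₀),
    IsIntermediateExtension α δ α₀ φ ψ₁ ψ₀ → IsCompactExtension δ α₀ ψ₀ →
    ∃ θ : α₁ → δ, IsFactorMap α₁ δ θ ∧
      (∀ᵐ x ∂α.μ, θ (φ₁ x) = ψ₁ x) ∧ (∀ᵐ x ∂α₁.μ, ψ₀ (θ x) = φ₀ x)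

/-- The distal tower of `α`: a directed family of factors `stage ζ` of `α`, for countable
ordinals `ζ`, with factor maps `proj ζ` from `α` and `bond ζ ξ` from `stage ξ` to `stage ζ`
(`ζ ≤ ξ`). Only the values at countable ordinals matter. At a limit ordinal `ξ`, `stage ξ` is
the inverse limit of the earlier stages: the map `x ↦ (bond ζ ξ x)_{ζ < ξ}`
into the product of the earlier stages is an isomorphism onto its image, that is, it is one-to-one
on a conull set. -/
structure DistalTower (α : PMPAction.{u} Γ) where
  stage : Ordinal.{0} → PMPAction.{u} Γ
  standard : ∀ ζ < ω₁, StandardBorelSpace (stage ζ)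
  proj : ∀ ζ, α → stage ζ
  bond : ∀ ζ ξ, stage ξ → stage ζ
  isFactorMap_proj : ∀ ζ < ω₁, IsFactorMap α (stage ζ) (proj ζ)
  isFactorMap_bond : ∀ ζ ξ, ζ ≤ ξ → ξ < ω₁ → IsFactorMap (stage ξ) (stage ζ) (bond ζ ξ)
  bond_proj : ∀ ζ ξ, ζ ≤ ξ → ξ < ω₁ → ∀ᵐ x ∂α.μ, bond ζ ξ (proj ξ x) = proj ζ x
  zero : Subsingleton (stage 0)
  succ : ∀ ζ < ω₁, IsLargestCompactExtension α (stage (ζ + 1)) (stage ζ)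
    (proj ζ) (proj (ζ + 1)) (bond ζ (ζ + 1))
  limit : ∀ ξ < ω₁, Order.IsSuccLimit ξ →
    AEInjective (stage ξ).μ (fun x (ζ : Set.Iio ξ) => bond ζ ξ x)

/-- A (measure) distal action: an ergodic action that is isomorphic, through the canonical factor
map, to some stage of its distal tower. -/
def IsMeasureDistal (α : PMPAction.{u} Γ) : Prop :=
  α.IsErgodic ∧ ∃ T : DistalTower α, ∃ ζ < ω₁, AEInjective α.μ (T.proj ζ)

end PMPAction

/-! Weak containment supplies maps `θ i : β → α`, indexed along an ultrafilter, that are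
asymptotically measure preserving and equivariant set by set
(`WeaklyContained.exists_asympFactorMap`). They need not converge, so one studies the sets `A` for
which the preimages `θ i ⁻¹' A` do converge in measure. These form a σ-algebra, `limitSpace`. If it
contains every measurable set, the limits come from a point map, and that map is a factor map
(`AsympFactorMap.isFactorOf`).

Strong ergodicity makes `limitSpace` pass up through a compact extension. Let `r` be the fibre
coordinate in `K ⧸ L`, with a `K`-invariant metric. Once the cocycle converges, `w γ (θ n y)` and `w
γ (θ m y)` nearly agree, so `y ↦ dist (r (θ n y)) (r (θ m y))` is almost invariant. By strong
ergodicity it is mostly small or mostly bounded below. The second case would give arbitrarily many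
points pairwise far apart in a compact space. Hence `r ∘ θ n` is Cauchy in measure, which means that
`r` is measurable for `limitSpace` (`AsympFactorMap.measurable_of_cocycle`). Transfinite induction
then climbs the distal tower. -/

set_option linter.unusedSectionVars false

/-! ### Convergence in measure of preimages, and the σ-algebra it defines -/

section Tracking

variable {ι X Y : Type*} [MeasurableSpace X] [MeasurableSpace Y]

/-- The preimages of `A` under the maps `θ i` converge to `B` in measure along `U`. -/
def Tracks (θ : ι → Y → X) (U : Filter ι) (ν : Measure Y) (A : Set X) (B : Set Y) : Prop :=
  Tendsto (fun i => ν.real ((θ i ⁻¹' A) ∆ B)) U (𝓝 0)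

/-- The maps `θ i` are asymptotically measure preserving along `U`, setwise. -/
structure AsympMeasurePreserving (θ : ι → Y → X) (U : Filter ι) (ν : Measure Y)
    (μ : Measure X) : Prop where
  measurable : ∀ i, Measurable (θ i)
  tendsto : ∀ A, MeasurableSet A → Tendsto (fun i => ν.real (θ i ⁻¹' A)) U (𝓝 (μ.real A))

variable {θ : ι → Y → X} {U : Filter ι} {ν : Measure Y} {μ : Measure X}

theorem Tracks.compl {A : Set X} {B : Set Y} (h : Tracks θ U ν A B) : Tracks θ U ν Aᶜ Bᶜ := by
  simpa only [Tracks, Set.preimage_compl, compl_symmDiff_compl] using h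

theorem Tracks.union [IsProbabilityMeasure ν] {A A' : Set X} {B B' : Set Y}
    (h : Tracks θ U ν A B) (h' : Tracks θ U ν A' B') : Tracks θ U ν (A ∪ A') (B ∪ B') := by
  refine squeeze_zero (fun _ => measureReal_nonneg) (fun i => ?_) (by simpa using h.add h')
  refine (measureReal_mono ?_).trans (measureReal_union_le _ _)
  intro y hy
  simp only [Set.mem_symmDiff, Set.mem_preimage, Set.mem_union] at hy ⊢
  tauto

theorem Tracks.ae_unique [IsProbabilityMeasure ν] [U.NeBot] {A : Set X} {B B' : Set Y}
    (h : Tracks θ U ν A B) (h' : Tracks θ U ν A B') : B =ᵐ[ν] B' := by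
  have h0 : ν.real (B ∆ B') ≤ 0 := by
    have hadd := h.add h'
    rw [add_zero] at hadd
    refine ge_of_tendsto hadd (Eventually.of_forall ?_)
    intro i
    have := measureReal_symmDiff_le (μ := ν) (s := B) (t := θ i ⁻¹' A) B'
    rwa [symmDiff_comm B (θ i ⁻¹' A)] at this
  rw [← measure_symmDiff_eq_zero_iff]
  simpa [measureReal_eq_zero_iff] using le_antisymm h0 measureReal_nonneg

theorem Tracks.of_symmDiff [IsProbabilityMeasure ν] {A : Set X} {B : Set Y} {C : ι → Set Y}
    (h : Tracks θ U ν A B) (hC : Tendsto (fun i => ν.real (C i ∆ (θ i ⁻¹' A))) U (𝓝 0)) :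
    Tendsto (fun i => ν.real (C i ∆ B)) U (𝓝 0) := by
  have hadd := hC.add h
  rw [add_zero] at hadd
  exact squeeze_zero (fun _ => measureReal_nonneg) (fun _ => measureReal_symmDiff_le _) hadd

theorem tendsto_measureReal_iUnion_sdiff_accumulate [IsProbabilityMeasure μ] {A : ℕ → Set X}
    (hA : ∀ n, MeasurableSet (A n)) :
    Tendsto (fun n => μ.real ((⋃ k, A k) \ Set.accumulate A n)) atTop (𝓝 0) := by
  have hacc : ∀ n, MeasurableSet (Set.accumulate A n) := fun n =>
    MeasurableSet.biUnion (Set.to_countable _) fun k _ => hA k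
  have h1 : Tendsto (fun n => μ.real (Set.accumulate A n)) atTop (𝓝 (μ.real (⋃ k, A k))) :=
    (ENNReal.tendsto_toReal (measure_ne_top _ _)).comp tendsto_measure_iUnion_accumulate
  have h2 := (tendsto_const_nhds (x := μ.real (⋃ k, A k))).sub h1
  rw [sub_self] at h2
  refine h2.congr fun n => ?_
  rw [measureReal_sdiff (Set.accumulate_subset_iUnion n) (hacc n)]

/-- Finite unions are immediate. The tail of the union has small `μ`-measure, and asymptotic measure
preservation keeps its preimages small eventually along `U`. -/
theorem AsympMeasurePreserving.tracks_iUnion [IsProbabilityMeasure ν] [IsProbabilityMeasure μ]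
    (hθ : AsympMeasurePreserving θ U ν μ) {A : ℕ → Set X} {B : ℕ → Set Y}
    (hA : ∀ n, MeasurableSet (A n)) (hB : ∀ n, MeasurableSet (B n))
    (h : ∀ n, Tracks θ U ν (A n) (B n)) : Tracks θ U ν (⋃ n, A n) (⋃ n, B n) := by
  have hacc : ∀ n, Tracks θ U ν (Set.accumulate A n) (Set.accumulate B n) := by
    intro n
    induction n with
    | zero => simpa using h 0
    | succ n ih => simpa [Set.accumulate_succ] using ih.union (h (n + 1))
  rw [Tracks, Metric.tendsto_nhds]
  intro ε hε
  have h3 : 0 < ε / 3 := by positivity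
  obtain ⟨n, hnA, hnB⟩ :=
    (((tendsto_measureReal_iUnion_sdiff_accumulate (μ := μ) hA).eventually_lt_const h3).and
    ((tendsto_measureReal_iUnion_sdiff_accumulate (μ := ν) hB).eventually_lt_const h3)).exists
  have hmeas : MeasurableSet ((⋃ k, A k) \ Set.accumulate A n) :=
    (MeasurableSet.iUnion hA).diff (MeasurableSet.biUnion (Set.to_countable _) fun k _ => hA k)
  filter_upwards [(hθ.tendsto _ hmeas).eventually_lt_const hnA,
    (hacc n).eventually_lt_const h3] with i h1 h2
  rw [Real.dist_0_eq_abs, abs_of_nonneg measureReal_nonneg]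
  have hsub : (θ i ⁻¹' ⋃ n, A n) ∆ (⋃ n, B n) ⊆
      (θ i ⁻¹' ((⋃ k, A k) \ Set.accumulate A n) ∪
        (θ i ⁻¹' Set.accumulate A n) ∆ Set.accumulate B n) ∪
        ((⋃ k, B k) \ Set.accumulate B n) := by
    have hA' := Set.accumulate_subset_iUnion (s := A) n
    have hB' := Set.accumulate_subset_iUnion (s := B) n
    intro y hy
    have := @hA' (θ i y)
    have := @hB' y
    simp only [Set.mem_symmDiff, Set.mem_preimage, Set.mem_union, Set.mem_sdiff] at hy ⊢
    tauto
  have := (measureReal_mono (μ := ν) hsub).trans (measureReal_union_le _ _)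
  have := measureReal_union_le (μ := ν) (θ i ⁻¹' ((⋃ k, A k) \ Set.accumulate A n))
    ((θ i ⁻¹' Set.accumulate A n) ∆ Set.accumulate B n)
  linarith

theorem AsympMeasurePreserving.tracks_congr [IsProbabilityMeasure ν] [IsProbabilityMeasure μ]
    (hθ : AsympMeasurePreserving θ U ν μ) {A A' : Set X} {B : Set Y}
    (hA : MeasurableSet A) (hA' : MeasurableSet A') (hAA' : A =ᵐ[μ] A')
    (h : Tracks θ U ν A B) : Tracks θ U ν A' B := by
  refine h.of_symmDiff ?_
  have h0 : μ.real (A' ∆ A) = 0 := by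
    rw [measureReal_eq_zero_iff, measure_symmDiff_eq_zero_iff]
    exact hAA'.symm
  simpa [h0] using hθ.tendsto _ (hA'.symmDiff hA)

/-- The σ-algebra of the measurable sets whose preimages converge in measure. -/
@[reducible]
def AsympMeasurePreserving.limitSpace [IsProbabilityMeasure ν] [IsProbabilityMeasure μ]
    (hθ : AsympMeasurePreserving θ U ν μ) : MeasurableSpace X where
  MeasurableSet' A := MeasurableSet A ∧ ∃ B, MeasurableSet B ∧ Tracks θ U ν A B
  measurableSet_empty := ⟨.empty, ∅, .empty, by simp [Tracks, tendsto_const_nhds]⟩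
  measurableSet_compl := by
    rintro A ⟨hA, B, hB, h⟩
    exact ⟨hA.compl, Bᶜ, hB.compl, h.compl⟩
  measurableSet_iUnion := by
    intro A h
    choose hA B hB h using h
    exact ⟨.iUnion hA, _, .iUnion hB, hθ.tracks_iUnion hA hB h⟩

theorem AsympMeasurePreserving.measurableSet_limitSpace_congr [IsProbabilityMeasure ν]
    [IsProbabilityMeasure μ] (hθ : AsympMeasurePreserving θ U ν μ) {A A' : Set X}
    (hA' : MeasurableSet A') (hAA' : A =ᵐ[μ] A') (h : MeasurableSet[hθ.limitSpace] A) :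
    MeasurableSet[hθ.limitSpace] A' := by
  obtain ⟨hA, B, hB, h⟩ := h
  exact ⟨hA', B, hB, hθ.tracks_congr hA hA' hAA' h⟩

/-- A point outside every consecutive difference from `n` on never changes membership after `n`, so
it lies in the limsup exactly when it lies in `B n`. -/
theorem symmDiff_limsup_subset (B : ℕ → Set Y) (n : ℕ) :
    B n ∆ (⋂ m, ⋃ k, B (m + k)) ⊆ ⋃ k, B (n + k) ∆ B (n + k + 1) := by
  intro y hy
  by_contra hcon
  simp only [Set.mem_iUnion, not_exists, Set.mem_symmDiff] at hcon
  have key : ∀ k, y ∈ B (n + k) ↔ y ∈ B n := by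
    intro k
    induction k with
    | zero => simp
    | succ k ih =>
      have := hcon k
      rw [← add_assoc]
      tauto
  rcases hy with ⟨h1, h2⟩ | ⟨h1, h2⟩
  · apply h2
    simp only [Set.mem_iInter, Set.mem_iUnion]
    intro m
    exact ⟨n, by rw [add_comm]; exact (key m).2 h1⟩
  · simp only [Set.mem_iInter, Set.mem_iUnion] at h1
    obtain ⟨k, hk⟩ := h1 n
    exact h2 ((key k).1 hk)

/-- Completeness of the measure algebra, by Borel–Cantelli: the limit is the limsup of approximants
`B k` with errors `2⁻ᵏ`. -/
theorem exists_tracks_of_cauchy [IsProbabilityMeasure ν] [U.NeBot] {A : Set X}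
    (h : ∀ ε > 0, ∃ B, MeasurableSet B ∧ ∀ᶠ i in U, ν.real ((θ i ⁻¹' A) ∆ B) < ε) :
    ∃ B, MeasurableSet B ∧ Tracks θ U ν A B := by
  have hpos : ∀ k : ℕ, (0 : ℝ) < (1 / 2) ^ k := fun k => by positivity
  choose B hB hBA using fun k : ℕ => h ((1 / 2) ^ k) (hpos k)
  have hstep : ∀ k, ν.real (B k ∆ B (k + 1)) ≤ 2 * (1 / 2) ^ k := by
    intro k
    obtain ⟨i, h1, h2⟩ := ((hBA k).and (hBA (k + 1))).exists
    have := measureReal_symmDiff_le (μ := ν) (s := B k) (t := θ i ⁻¹' A) (B (k + 1))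
    rw [symmDiff_comm (B k) (θ i ⁻¹' A)] at this
    have h3 : (1 / 2 : ℝ) ^ (k + 1) ≤ (1 / 2) ^ k := by
      rw [pow_succ]; linarith [hpos k]
    linarith
  have htail : ∀ n, ν.real (B n ∆ (⋂ m, ⋃ k, B (m + k))) ≤ 4 * (1 / 2) ^ n := by
    intro n
    refine ENNReal.toReal_le_of_le_ofReal (by positivity) ?_
    refine (measure_mono (symmDiff_limsup_subset B n)).trans
      ((measure_iUnion_le _).trans ?_)
    have hs : HasSum (fun k : ℕ => 2 * (1 / 2 : ℝ) ^ n * (1 / 2) ^ k) (4 * (1 / 2) ^ n) := by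
      rw [show 4 * (1 / 2 : ℝ) ^ n = 2 * (1 / 2) ^ n * 2 by ring]
      exact hasSum_geometric_two.mul_left _
    rw [← hs.tsum_eq, ENNReal.ofReal_tsum_of_nonneg (fun k => by positivity) hs.summable]
    refine ENNReal.tsum_le_tsum fun k => ?_
    rw [← ofReal_measureReal]
    refine ENNReal.ofReal_le_ofReal ((hstep (n + k)).trans (le_of_eq ?_))
    rw [pow_add]; ring
  refine ⟨⋂ m, ⋃ k, B (m + k), .iInter fun m => .iUnion fun k => hB _, ?_⟩
  rw [Tracks, Metric.tendsto_nhds]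
  intro ε hε
  -- The total error is `2⁻ⁿ` from `hBA` plus `4 * 2⁻ⁿ` from `htail`.
  obtain ⟨n, hn⟩ := exists_pow_lt_of_lt_one (by positivity : 0 < ε / 5)
    (by norm_num : (1 / 2 : ℝ) < 1)
  filter_upwards [hBA n] with i hi
  rw [Real.dist_0_eq_abs, abs_of_nonneg measureReal_nonneg]
  have := measureReal_symmDiff_le (μ := ν) (s := θ i ⁻¹' A) (t := B n) (⋂ m, ⋃ k, B (m + k))
  linarith [htail n]

variable {Z : Type*} [PseudoMetricSpace Z]

theorem setOf_le_dist_subset {ε : ℝ} {t : Set Z} (ht : (Set.univ : Set Z) ⊆ ⋃ z ∈ t,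
    Metric.ball z (ε / 2)) (a b : Y → Z) : {y | ε ≤ dist (a y) (b y)} ⊆
      ⋃ z ∈ t, (a ⁻¹' Metric.ball z (ε / 2)) ∆ (b ⁻¹' Metric.ball z (ε / 2)) := by
  intro y hy
  obtain ⟨z, hz, hyz⟩ := Set.mem_iUnion₂.1 (ht (Set.mem_univ (a y)))
  refine Set.mem_iUnion₂.2 ⟨z, hz, Or.inl ⟨hyz, fun hb => ?_⟩⟩
  simp only [Set.mem_preimage, Metric.mem_ball, Set.mem_ofPred_eq] at hyz hb hy
  linarith [dist_triangle_right (a y) (b y) z]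

/-- Two families of maps into a compact space which pull back sets in asymptotically the same
way are close in measure. -/
theorem eventually_dist_of_symmDiff [IsProbabilityMeasure ν] [CompactSpace Z]
    [MeasurableSpace Z] [OpensMeasurableSpace Z] {a b : ι → Y → Z}
    (h : ∀ E, MeasurableSet E → Tendsto (fun i => ν.real ((a i ⁻¹' E) ∆ (b i ⁻¹' E))) U (𝓝 0))
    {ε : ℝ} (hε : 0 < ε) : ∀ᶠ i in U, ν.real {y | ε ≤ dist (a i y) (b i y)} < ε := by
  obtain ⟨t, -, htf, ht⟩ := finite_cover_balls_of_compact (X := Z) isCompact_univ (half_pos hε)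
  lift t to Finset Z using htf
  have hsum : Tendsto (fun i => ∑ z ∈ t,
      ν.real ((a i ⁻¹' Metric.ball z (ε / 2)) ∆ (b i ⁻¹' Metric.ball z (ε / 2)))) U (𝓝 0) := by
    simpa using tendsto_finsetSum t fun z _ => h _ (Metric.isOpen_ball (x := z)).measurableSet
  filter_upwards [hsum.eventually_lt_const hε] with i hi
  refine ((measureReal_mono (setOf_le_dist_subset ht (a i) (b i))
    (measure_ne_top _ _)).trans ?_).trans_lt hi
  exact measureReal_biUnion_finset_le t _

/-- If the preimages of the sets `f ⁻¹' E` converge, then `f ∘ θ i` is Cauchy in measure. -/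
theorem AsympMeasurePreserving.eventually_dist_lt [IsProbabilityMeasure ν]
    [IsProbabilityMeasure μ] (hθ : AsympMeasurePreserving θ U ν μ) [CompactSpace Z]
    [MeasurableSpace Z] [OpensMeasurableSpace Z] {f : X → Z}
    (hf : Measurable[hθ.limitSpace] f) {ε : ℝ} (hε : 0 < ε) :
    ∀ᶠ p in U ×ˢ U, ν.real {y | ε ≤ dist (f (θ p.1 y)) (f (θ p.2 y))} < ε := by
  refine eventually_dist_of_symmDiff (U := U ×ˢ U) (a := fun p y => f (θ p.1 y))
    (b := fun p y => f (θ p.2 y)) (fun E hE => ?_) hε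
  obtain ⟨-, B, hB, h⟩ := hf hE
  refine squeeze_zero (fun _ => measureReal_nonneg)
    (fun p => measureReal_symmDiff_le (μ := ν) (t := B) _) ?_
  have h1 := (h.comp (tendsto_fst (f := U) (g := U))).add
    (h.comp (tendsto_snd (f := U) (g := U)))
  simp only [add_zero] at h1
  refine h1.congr fun p => ?_
  rw [symmDiff_comm B]
  rfl

theorem tendsto_measureReal_thickening_sdiff {Z : Type*} [PseudoMetricSpace Z]
    [MeasurableSpace Z] [OpensMeasurableSpace Z] (m : Measure Z) [IsProbabilityMeasure m]
    {E : Set Z} (hE : IsClosed E) {ε : ℝ} (hε : 0 < ε) :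
    ∃ δ > 0, m.real (Metric.thickening δ E \ E) < ε := by
  have h1 : Tendsto (fun r => m (Metric.thickening r E)) (𝓝[>] 0) (𝓝 (m E)) :=
    tendsto_measure_thickening_of_isClosed ⟨1, one_pos, measure_ne_top _ _⟩ hE
  have h2 : Tendsto (fun r => m.real (Metric.thickening r E)) (𝓝[>] 0) (𝓝 (m.real E)) :=
    (ENNReal.tendsto_toReal (measure_ne_top _ _)).comp h1
  obtain ⟨δ, hδ, hδ0⟩ := ((h2.eventually_lt_const (lt_add_of_pos_right _ hε)).and
    self_mem_nhdsWithin).exists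
  refine ⟨δ, hδ0, ?_⟩
  rw [measureReal_sdiff (Metric.self_subset_thickening hδ0 E) hE.measurableSet]
  linarith

/-- If `f ∘ θ i` is Cauchy in measure, then the preimages of the sets `f ⁻¹' E` converge. -/
theorem AsympMeasurePreserving.measurable_limitSpace [IsProbabilityMeasure ν]
    [IsProbabilityMeasure μ] [U.NeBot] (hθ : AsympMeasurePreserving θ U ν μ)
    [MeasurableSpace Z] [BorelSpace Z] {f : X → Z} (hf : Measurable f)
    (h : ∀ ε > 0, ∀ᶠ n in U, ∀ᶠ m in U,
      ν.real {y | ε ≤ dist (f (θ n y)) (f (θ m y))} < ε) :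
    Measurable[hθ.limitSpace] f := by
  -- Closed sets suffice since `limitSpace` is a σ-algebra. For closed `E`, two nearby values that
  -- disagree about membership in `E` put one of them in the shell `thickening δ E \ E`, which has
  -- small measure.
  refine @measurable_of_isClosed _ _ _ _ _ hθ.limitSpace _ fun E hE => ?_
  refine ⟨hf hE.measurableSet, exists_tracks_of_cauchy fun ε hε => ?_⟩
  have := Measure.isProbabilityMeasure_map (μ := μ) hf.aemeasurable
  obtain ⟨δ, hδ, hδE⟩ := tendsto_measureReal_thickening_sdiff (μ.map f) hE
    (by positivity : 0 < ε / 3)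
  have hTm : MeasurableSet (Metric.thickening δ E \ E) :=
    Metric.isOpen_thickening.measurableSet.diff hE.measurableSet
  rw [map_measureReal_apply hf hTm] at hδE
  have hev := (hθ.tendsto _ (hf hTm)).eventually_lt_const hδE
  obtain ⟨n, hn1, hn2⟩ := ((h (min δ (ε / 3)) (by positivity)).and hev).exists
  refine ⟨θ n ⁻¹' (f ⁻¹' E), hθ.measurable n (hf hE.measurableSet), ?_⟩
  filter_upwards [hn1, hev] with m hm1 hm2
  have hsub : (θ m ⁻¹' (f ⁻¹' E)) ∆ (θ n ⁻¹' (f ⁻¹' E)) ⊆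
      ({y | min δ (ε / 3) ≤ dist (f (θ n y)) (f (θ m y))} ∪
        θ n ⁻¹' (f ⁻¹' (Metric.thickening δ E \ E))) ∪
        θ m ⁻¹' (f ⁻¹' (Metric.thickening δ E \ E)) := by
    intro y hy
    by_cases hd : min δ (ε / 3) ≤ dist (f (θ n y)) (f (θ m y))
    · exact Or.inl (Or.inl hd)
    have hd' : dist (f (θ n y)) (f (θ m y)) < δ := (not_le.1 hd).trans_le (min_le_left _ _)
    rcases hy with ⟨h1, h2⟩ | ⟨h1, h2⟩
    · exact Or.inl (Or.inr ⟨Metric.mem_thickening_iff.2 ⟨_, h1, hd'⟩, h2⟩)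
    · exact Or.inr ⟨Metric.mem_thickening_iff.2 ⟨_, h1, by rwa [dist_comm]⟩, h2⟩
  have h1 := (measureReal_mono (μ := ν) hsub).trans (measureReal_union_le _ _)
  have h2 := measureReal_union_le (μ := ν) {y | min δ (ε / 3) ≤ dist (f (θ n y)) (f (θ m y))}
    (θ n ⁻¹' (f ⁻¹' (Metric.thickening δ E \ E)))
  have h3 := min_le_right δ (ε / 3)
  linarith

end Tracking

/-! ### Strong ergodicity: almost invariant functions and Cauchy families -/

namespace PMPAction

variable {Γ : Type w} [Group Γ]

theorem IsStronglyErgodic.exists_finset [Countable Γ] {β : PMPAction.{v} Γ}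
    (hβ : β.IsStronglyErgodic) {η : ℝ} (hη : 0 < η) :
    ∃ S : Finset Γ, ∃ δ > 0, ∀ A : Set β, MeasurableSet A →
      (∀ γ ∈ S, β.μ.real (((γ • ·) ⁻¹' A) ∆ A) < δ) →
      β.μ.real A * (1 - β.μ.real A) < η := by
  classical
  by_contra! hcon
  obtain ⟨e, he⟩ := exists_surjective_nat Γ
  choose A hA hinv hlarge using fun n : ℕ =>
    -- Inverses appear because the preimage of `A` under `γ⁻¹` is the translate `γ • A` used in
    -- `IsStronglyErgodic`.
    hcon ((Finset.range n).image fun k => (e k)⁻¹) (1 / ((n : ℝ) + 1)) (by positivity)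
  have hlim := hβ A hA fun γ => by
    obtain ⟨k, rfl⟩ := he γ
    refine squeeze_zero' (Eventually.of_forall fun _ => measureReal_nonneg) ?_
      tendsto_one_div_add_atTop_nhds_zero_nat
    filter_upwards [eventually_gt_atTop k] with n hn
    have := hinv n (e k)⁻¹ (Finset.mem_image.2 ⟨k, Finset.mem_range.2 hn, rfl⟩)
    rw [Set.preimage_smul, inv_inv] at this
    exact this.le
  obtain ⟨n, hn⟩ := (hlim.eventually_lt_const hη).exists
  exact (hlarge n).not_gt hn

/-- Under a strongly ergodic action, an almost invariant function is either mostly below `ε` or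
mostly above `ε / 2`. -/
theorem IsStronglyErgodic.level_dichotomy [Countable Γ] {β : PMPAction.{v} Γ}
    (hβ : β.IsStronglyErgodic) {ε η : ℝ} (hε : 0 < ε) (hη : 0 < η) :
    ∃ S : Finset Γ, ∃ δ > 0, ∀ f : β → ℝ, Measurable f →
      (∀ γ ∈ S, β.μ.real {y | δ ≤ |f (γ • y) - f y|} < δ) →
      β.μ.real {y | ε ≤ f y} < η ∨ β.μ.real {y | f y < ε / 2} < η := by
  obtain ⟨S, δ₀, hδ₀, hS⟩ := hβ.exists_finset (half_pos hη)
  obtain ⟨M, hM⟩ := exists_nat_one_div_lt (half_pos hδ₀)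
  set N : ℕ := M + 1 with hN
  have hNpos : (0 : ℝ) < N := by positivity
  have hMN : 1 / (N : ℝ) < δ₀ / 2 := by rw [hN]; push_cast; exact hM
  set δ := min (ε / (4 * N)) (δ₀ / 2) with hδ
  have hδpos : 0 < δ := by positivity
  have hδε : δ * (4 * N) ≤ ε := by
    rw [← le_div_iff₀ (by positivity)]; exact min_le_left _ _
  refine ⟨S, δ, hδpos, fun f hf hinv => ?_⟩
  -- `N` disjoint bands of width `2 * δ` fit between `ε / 2` and `ε`, so one has measure at most `1
  -- / N`. Its centre is the cutting level: a point that crosses it while moving less than `δ` lies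
  -- in the band, so the superlevel set is almost invariant.
  set t : ℕ → ℝ := fun k => ε / 2 + (2 * k + 1) * δ with ht
  have hband : ∀ k, MeasurableSet {y | |f y - t k| < δ} := fun k =>
    measurableSet_lt (by fun_prop) measurable_const
  have hdisj : Set.PairwiseDisjoint (↑(Finset.range N)) fun k => {y | |f y - t k| < δ} := by
    intro k _ l _ hkl
    rw [Function.onFun, Set.disjoint_left]
    intro y hk hl
    simp only [Set.mem_ofPred_eq, abs_lt, ht] at hk hl
    rcases lt_or_gt_of_ne hkl with h | h
    · have : (k : ℝ) + 1 ≤ l := by exact_mod_cast h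
      nlinarith
    · have : (l : ℝ) + 1 ≤ k := by exact_mod_cast h
      nlinarith
  have hsum : ∑ k ∈ Finset.range N, β.μ.real {y | |f y - t k| < δ} ≤
      ∑ _k ∈ Finset.range N, 1 / (N : ℝ) := by
    rw [← measureReal_biUnion_finset hdisj fun k _ => hband k]
    simp [hNpos.ne']
  obtain ⟨k, hkN, hk⟩ := Finset.exists_le_of_sum_le (by simp [hN]) hsum
  have hkN' : (k : ℝ) + 1 ≤ N := by exact_mod_cast Finset.mem_range.1 hkN
  have htk : ε / 2 ≤ t k := by simp only [ht]; nlinarith [k.cast_nonneg (α := ℝ)]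
  have htk' : t k ≤ ε := by simp only [ht]; nlinarith
  have hA : MeasurableSet {y | t k ≤ f y} := measurableSet_le measurable_const hf
  have hsmall := hS {y | t k ≤ f y} hA fun γ hγ => by
    have hsub : ((γ • · : β → β) ⁻¹' {y | t k ≤ f y}) ∆ {y | t k ≤ f y} ⊆
        {y | δ ≤ |f (γ • y) - f y|} ∪ {y | |f y - t k| < δ} := by
      intro y hy
      by_cases h : δ ≤ |f (γ • y) - f y|
      · exact Or.inl h
      refine Or.inr ?_
      simp only [Set.mem_symmDiff, Set.mem_preimage, Set.mem_ofPred_eq, not_le, abs_lt] at hy h ⊢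
      rcases hy with ⟨h1, h2⟩ | ⟨h1, h2⟩ <;> constructor <;> linarith
    have h1 := (measureReal_mono (μ := β.μ) hsub).trans (measureReal_union_le _ _)
    have h2 := hinv γ hγ
    have h3 : δ ≤ δ₀ / 2 := min_le_right _ _
    linarith
  have hle : β.μ.real {y | ε ≤ f y} ≤ β.μ.real {y | t k ≤ f y} :=
    measureReal_mono fun y hy => htk'.trans hy
  have hle' : β.μ.real {y | f y < ε / 2} ≤ 1 - β.μ.real {y | t k ≤ f y} := by
    rw [← probReal_compl_eq_one_sub hA]
    refine measureReal_mono fun y hy => ?_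
    simp only [Set.mem_compl_iff, Set.mem_ofPred_eq, not_le] at hy ⊢
    linarith
  by_contra! hcon
  -- If a number and its complement to 1 are both at least `η`, one of them is at least `1 / 2` and
  -- the product is at least `η / 2`.
  nlinarith [hcon.1, hcon.2]

/-- If the mutual distances of maps into a compact space are asymptotically invariant under a
strongly ergodic action, then along an ultrafilter the maps are Cauchy in measure. -/
theorem IsStronglyErgodic.eventually_dist_lt [Countable Γ] {β : PMPAction.{v} Γ}
    (hβ : β.IsStronglyErgodic) {ι Z : Type*} {U : Ultrafilter ι} [PseudoMetricSpace Z]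
    [CompactSpace Z] [MeasurableSpace Z] [OpensMeasurableSpace Z] {R : ι → β → Z}
    (hR : ∀ i, Measurable (R i))
    (hinv : ∀ γ : Γ, ∀ ε > 0, ∀ᶠ n in U, ∀ᶠ m in U, β.μ.real
      {y | ε ≤ |dist (R n (γ • y)) (R m (γ • y)) - dist (R n y) (R m y)|} < ε) :
    ∀ ε > 0, ∀ᶠ n in U, ∀ᶠ m in U, β.μ.real {y | ε ≤ dist (R n y) (R m y)} < ε := by
  classical
  intro ε hε
  obtain ⟨t, -, htf, ht⟩ := finite_cover_balls_of_compact (X := Z) isCompact_univ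
    (by positivity : 0 < ε / 4)
  lift t to Finset Z using htf
  -- More indices than covering balls, for the pigeonhole; `η` is small enough that the exceptional
  -- sets of all pairs below `N` together do not fill the space.
  set N := t.card + 1 with hN
  set η := min ε (1 / ((N * N : ℕ) + 1 : ℝ)) with hη
  have hηpos : 0 < η := by positivity
  obtain ⟨S, δ, hδ, hS⟩ := hβ.level_dichotomy hε hηpos
  have hSinv : ∀ᶠ n in U, ∀ᶠ m in U, ∀ γ ∈ S, β.μ.real
      {y | δ ≤ |dist (R n (γ • y)) (R m (γ • y)) - dist (R n y) (R m y)|} < δ := by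
    simp only [Filter.eventually_all_finset]
    exact fun γ _ => hinv γ δ hδ
  by_contra hcon
  -- Here the ultrafilter matters: failure of an eventual statement is the eventual negation, so the
  -- dichotomy lands in the separated case for most `n` and then most `m`.
  have hsep : ∀ᶠ n in U, ∀ᶠ m in U, β.μ.real {y | dist (R n y) (R m y) < ε / 2} < η := by
    filter_upwards [hSinv, Ultrafilter.eventually_not.2 hcon] with n h1 h2
    filter_upwards [h1, Ultrafilter.eventually_not.2 h2] with m h3 h4
    refine (hS _ ((hR n).dist (hR m)) h3).resolve_left fun h5 => h4 ?_
    exact h5.trans_le (min_le_left _ _)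
  obtain ⟨f, -, hf⟩ := exists_seq_of_forall_finset_exists
    (fun n => ∀ᶠ m in U, β.μ.real {y | dist (R n y) (R m y) < ε / 2} < η)
    (fun n m => β.μ.real {y | dist (R n y) (R m y) < ε / 2} < η) (fun s hs =>
      (hsep.and ((Filter.eventually_all_finset s).2 hs)).exists)
  set P := (Finset.range N ×ˢ Finset.range N).filter fun p => p.1 < p.2 with hP
  have hcard : (P.card : ℝ) ≤ (N * N : ℕ) := by
    exact_mod_cast (Finset.card_filter_le _ _).trans (by simp)
  have hunion : β.μ.real (⋃ p ∈ P, {y | dist (R (f p.1) y) (R (f p.2) y) < ε / 2}) < 1 := by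
    refine (measureReal_biUnion_finset_le P _).trans_lt ?_
    have h1 : ∑ p ∈ P, β.μ.real {y | dist (R (f p.1) y) (R (f p.2) y) < ε / 2} ≤
        P.card • η :=
      Finset.sum_le_card_nsmul _ _ _ fun p hp => (hf _ _ (Finset.mem_filter.1 hp).2).le
    have h2 : η ≤ 1 / ((N * N : ℕ) + 1 : ℝ) := min_le_right _ _
    rw [le_div_iff₀ (by positivity)] at h2
    rw [nsmul_eq_mul] at h1
    nlinarith
  -- At this `y` the points `R (f k) y`, `k < N`, are pairwise at least `ε / 2` apart, yet two of
  -- them share a ball of radius `ε / 4`.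
  obtain ⟨y, hy⟩ : ∃ y, y ∉ ⋃ p ∈ P, {y | dist (R (f p.1) y) (R (f p.2) y) < ε / 2} := by
    by_contra! hall
    rw [Set.eq_univ_of_forall hall, probReal_univ] at hunion
    exact lt_irrefl _ hunion
  have hcov : ∀ k : ℕ, ∃ z ∈ t, dist (R (f k) y) z < ε / 4 := fun k => by
    simpa using ht (Set.mem_univ (R (f k) y))
  choose c hct hc using hcov
  obtain ⟨k, hk, l, hl, hkl, hckl⟩ := Finset.exists_ne_map_eq_of_card_lt_of_maps_to
    (s := Finset.range N) (t := t) (by simp [hN]) (f := c) fun k _ => hct k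
  have hclose : ∀ k l, c k = c l → dist (R (f k) y) (R (f l) y) < ε / 2 := fun k l h => by
    have h1 := hc k
    have h2 := hc l
    rw [← h] at h2
    linarith [dist_triangle_right (R (f k) y) (R (f l) y) (c k)]
  refine hy ?_
  rcases lt_or_gt_of_ne hkl with h | h
  · exact Set.mem_iUnion₂.2 ⟨(k, l), Finset.mem_filter.2 ⟨Finset.mk_mem_product hk hl, h⟩,
      hclose k l hckl⟩
  · exact Set.mem_iUnion₂.2 ⟨(l, k), Finset.mem_filter.2 ⟨Finset.mk_mem_product hl hk, h⟩,
      hclose l k hckl.symm⟩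

/-! ### From weak containment to asymptotic factor maps -/

theorem measureReal_smul_inter_biUnion (β : PMPAction.{v} Γ) {n : ℕ} {B : Fin n → Set β}
    (hB : IsMeasurablePartition B) (γ : Γ) (J J' : Finset (Fin n)) :
    β.μ.real ((γ • ⋃ j ∈ J, B j) ∩ ⋃ j ∈ J', B j) =
      ∑ p ∈ J ×ˢ J', β.μ.real ((γ • B p.1) ∩ B p.2) := by
  rw [← measureReal_biUnion_finset]
  · congr 1
    ext y
    simp only [Set.smul_set_iUnion, Set.mem_inter_iff, Set.mem_iUnion, Finset.mem_product,
      Prod.exists, exists_prop]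
    constructor
    · rintro ⟨⟨i, hi, h⟩, j, hj, h'⟩
      exact ⟨i, j, ⟨hi, hj⟩, h, h'⟩
    · rintro ⟨i, j, ⟨hi, hj⟩, h, h'⟩
      exact ⟨⟨i, hi, h⟩, j, hj, h'⟩
  · rintro ⟨i, j⟩ _ ⟨i', j'⟩ _ hne
    rw [Function.onFun, Set.disjoint_left]
    rintro y ⟨h1, h2⟩ ⟨h3, h4⟩
    apply hne
    rw [Set.mem_smul_set_iff_inv_smul_mem] at h1 h3
    have hi : i = i' := by
      by_contra h
      exact Set.disjoint_left.1 (hB.disjoint h) h1 h3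
    have hj : j = j' := by
      by_contra h
      exact Set.disjoint_left.1 (hB.disjoint h) h2 h4
    rw [hi, hj]
  · exact fun p _ => ((hB.measurableSet _).const_smul γ).inter (hB.measurableSet _)

/-- Weak containment yields simple maps which are almost equivariant and almost measure
preserving on prescribed sets. -/
theorem WeaklyContained.exists_map {α : PMPAction.{u} Γ} {β : PMPAction.{v} Γ}
    (h : α.WeaklyContained β) (S : Finset Γ) (F : Finset (Set α))
    (hF : ∀ A ∈ F, MeasurableSet A) {ε : ℝ} (hε : 0 < ε) :
    ∃ θ : β → α, Measurable θ ∧ ∀ γ ∈ S, ∀ A ∈ F, ∀ A' ∈ F,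
      |α.μ.real ((γ • A) ∩ A') - β.μ.real ((γ • (θ ⁻¹' A)) ∩ θ ⁻¹' A')| < ε := by
  classical
  set c : α → (F → Prop) := fun x A => x ∈ A.1 with hc
  set n := Nat.card (Set.range c)
  let e : Set.range c ≃ Fin n := Finite.equivFin _
  have hex : ∀ j : Fin n, ∃ x, c x = (e.symm j).1 := fun j => (e.symm j).2
  choose x hx using hex
  let A : Fin n → Set α := fun j => {z | c z = c (x j)}
  have hApart : IsMeasurablePartition A := by
    refine ⟨fun j => ?_, fun i j hij => ?_, ?_⟩
    · have : A j = ⋂ B : F, {z | z ∈ B.1 ↔ x j ∈ B.1} := by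
        ext z
        simp [A, hc, funext_iff]
      rw [this]
      refine MeasurableSet.iInter fun B => ?_
      by_cases hB : x j ∈ B.1
      · simpa [hB] using hF _ B.2
      · simp only [hB, iff_false]
        exact (hF _ B.2).compl
    · refine Set.disjoint_left.2 fun z hi hj => ?_
      apply hij
      have : c (x i) = c (x j) := hi.symm.trans hj
      rw [hx, hx] at this
      exact e.symm.injective (Subtype.ext this)
    · refine Set.eq_univ_of_forall fun z => Set.mem_iUnion.2 ⟨e ⟨c z, z, rfl⟩, ?_⟩
      simp [A, hx]
  obtain ⟨B, hB, hBA⟩ := h S n A hApart (ε / ((n * n : ℕ) + 1)) (by positivity)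
  have hidx : ∀ y, ∃ j, y ∈ B j := fun y => by
    simpa using hB.iUnion_eq.ge (Set.mem_univ y)
  choose idx hidx using hidx
  have hpre : ∀ E : Set α, (fun y => x (idx y)) ⁻¹' E =
      ⋃ j ∈ Finset.univ.filter fun j => x j ∈ E, B j := by
    intro E
    ext y
    simp only [Set.mem_preimage, Set.mem_iUnion, Finset.mem_filter, Finset.mem_univ, true_and,
      exists_prop]
    refine ⟨fun hy => ⟨_, hy, hidx y⟩, ?_⟩
    rintro ⟨j, hj, hyj⟩
    have : idx y = j := by
      by_contra hne
      exact Set.disjoint_left.1 (hB.disjoint hne) (hidx y) hyj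
    rwa [this]
  have hdec : ∀ E ∈ F, E = ⋃ j ∈ Finset.univ.filter fun j => x j ∈ E, A j := by
    intro E hE
    ext z
    simp only [Set.mem_iUnion, Finset.mem_filter, Finset.mem_univ, true_and, exists_prop]
    have hiff : ∀ j, z ∈ A j → (z ∈ E ↔ x j ∈ E) := fun j hj =>
      iff_of_eq (congrFun hj ⟨E, hE⟩)
    constructor
    · intro hz
      obtain ⟨j, hj⟩ : ∃ j, z ∈ A j := by simpa using hApart.iUnion_eq.ge (Set.mem_univ z)
      exact ⟨j, (hiff j hj).1 hz, hj⟩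
    · rintro ⟨j, hj, hzj⟩
      exact (hiff j hzj).2 hj
  refine ⟨fun y => x (idx y), fun E _ => ?_, fun γ hγ E hE E' hE' => ?_⟩
  · rw [hpre]
    exact Finset.measurableSet_biUnion _ fun j _ => hB.measurableSet j
  · rw [hpre, hpre]
    nth_rw 1 [hdec E hE]
    nth_rw 1 [hdec E' hE']
    rw [measureReal_smul_inter_biUnion α hApart, measureReal_smul_inter_biUnion β hB,
      ← Finset.sum_sub_distrib]
    set J := (Finset.univ.filter fun j => x j ∈ E) ×ˢ Finset.univ.filter fun j => x j ∈ E'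
    have hcard : (J.card : ℝ) ≤ (n * n : ℕ) := by
      have h1 := Finset.card_le_univ J
      rw [Fintype.card_prod, Fintype.card_fin] at h1
      exact_mod_cast h1
    refine (Finset.abs_sum_le_sum_abs _ _).trans_lt ?_
    refine (Finset.sum_le_card_nsmul _ _ _ fun p _ => (hBA γ hγ p.1 p.2).le).trans_lt ?_
    rw [nsmul_eq_mul, ← mul_div_assoc, div_lt_iff₀ (by positivity)]
    nlinarith

/-- The maps `θ i` are, setwise, asymptotically measure preserving and equivariant. -/
structure AsympFactorMap {ι : Type*} (β : PMPAction.{v} Γ) (α : PMPAction.{u} Γ)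
    (θ : ι → β → α) (U : Filter ι) : Prop extends
    AsympMeasurePreserving θ U β.μ α.μ where
  equivariant : ∀ (γ : Γ) (A : Set α), MeasurableSet A → Tendsto (fun i => β.μ.real
    (((fun y => θ i (γ • y)) ⁻¹' A) ∆ ((fun y => γ • θ i y) ⁻¹' A))) U (𝓝 0)

theorem WeaklyContained.exists_asympFactorMap {α : PMPAction.{u} Γ} {β : PMPAction.{v} Γ}
    (h : α.WeaklyContained β) : ∃ (ι : Type (max u w)) (U : Ultrafilter ι) (θ : ι → β → α),
      AsympFactorMap β α θ U := by
  classical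
  let ι := Finset Γ × Finset {A : Set α // MeasurableSet A} × ℕ
  choose θ hθm hθ using fun i : ι => h.exists_map i.1 (i.2.1.map (Function.Embedding.subtype _))
    (fun A hA => by
      obtain ⟨B, -, rfl⟩ := Finset.mem_map.1 hA
      exact B.2) (Nat.one_div_pos_of_nat (α := ℝ) (n := i.2.2))
  have key : ∀ (γ : Γ) (A A' : Set α), MeasurableSet A → MeasurableSet A' → Tendsto
      (fun i => β.μ.real ((γ • (θ i ⁻¹' A)) ∩ θ i ⁻¹' A')) atTop
      (𝓝 (α.μ.real ((γ • A) ∩ A'))) := by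
    intro γ A A' hA hA'
    rw [Metric.tendsto_nhds]
    intro ε hε
    obtain ⟨n, hn⟩ := exists_nat_one_div_lt hε
    filter_upwards [eventually_ge_atTop (({γ}, {⟨A, hA⟩, ⟨A', hA'⟩}, n) : ι)] with i hi
    obtain ⟨h1, h2, h3⟩ : _ ∧ _ ∧ _ := hi
    rw [dist_comm, Real.dist_eq]
    refine (hθ i γ (h1 (by simp)) A ?_ A' ?_).trans (lt_of_le_of_lt ?_ hn)
    · exact Finset.mem_map.2 ⟨⟨A, hA⟩, h2 (by simp), rfl⟩
    · exact Finset.mem_map.2 ⟨⟨A', hA'⟩, h2 (by simp), rfl⟩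
    · exact Nat.one_div_le_one_div h3
  have htend : ∀ A, MeasurableSet A →
      Tendsto (fun i => β.μ.real (θ i ⁻¹' A)) atTop (𝓝 (α.μ.real A)) := fun A hA => by
    simpa using key 1 A A hA hA
  refine ⟨ι, Ultrafilter.of atTop, θ, ⟨⟨hθm, fun A hA => (htend A hA).mono_left
    (Ultrafilter.of_le _)⟩, fun γ A hA => Tendsto.mono_left ?_ (Ultrafilter.of_le _)⟩⟩
  have hA' : MeasurableSet (γ⁻¹ • A) := hA.const_smul _
  have hlim := ((htend A hA).add (htend _ hA')).sub ((key γ⁻¹ A _ hA hA').const_mul 2)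
  have hinv : α.μ.real (γ⁻¹ • A) = α.μ.real A := by simp [measureReal_def, measure_smul]
  rw [Set.inter_self, hinv, ← two_mul, sub_self] at hlim
  refine hlim.congr fun i => ?_
  have e1 : (fun y => θ i (γ • y)) ⁻¹' A = γ⁻¹ • (θ i ⁻¹' A) := by
    rw [← Set.preimage_smul]; rfl
  have e2 : (fun y => γ • θ i y) ⁻¹' A = θ i ⁻¹' (γ⁻¹ • A) := by
    rw [← Set.preimage_smul]; rfl
  have m1 : MeasurableSet (γ⁻¹ • (θ i ⁻¹' A)) := (hθm i hA).const_smul _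
  have m2 : MeasurableSet (θ i ⁻¹' (γ⁻¹ • A)) := hθm i hA'
  have hinv' : β.μ.real (γ⁻¹ • (θ i ⁻¹' A)) = β.μ.real (θ i ⁻¹' A) := by
    simp [measureReal_def, measure_smul]
  rw [e1, e2, measureReal_symmDiff_eq m1 m2, ← hinv']
  have h1 := measureReal_inter_add_sdiff (μ := β.μ) (s := γ⁻¹ • (θ i ⁻¹' A)) m2
  have h2 := measureReal_inter_add_sdiff (μ := β.μ) (s := θ i ⁻¹' (γ⁻¹ • A)) m1
  rw [Set.inter_comm] at h2
  linarith

end PMPAction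

theorem PMPAction.AEInjective.exists_preimage_ae_eq {X : Type u} {Z : Type v} [MeasurableSpace X]
    [StandardBorelSpace X] [MeasurableSpace Z] [MeasurableSpace.CountablySeparated Z]
    {μ : Measure X} {f : X → Z} (hinj : PMPAction.AEInjective μ f) (hf : Measurable f)
    {A : Set X} (hA : MeasurableSet A) : ∃ C, MeasurableSet C ∧ f ⁻¹' C =ᵐ[μ] A := by
  obtain ⟨s, hs, hinj⟩ := hinj
  set t := (toMeasurable μ sᶜ)ᶜ with ht
  have hts : t ⊆ s := Set.compl_subset_comm.1 (subset_toMeasurable μ sᶜ)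
  have htm : MeasurableSet t := (measurableSet_toMeasurable μ sᶜ).compl
  have ht0 : ∀ᵐ x ∂μ, x ∈ t := by
    rw [ae_iff]
    change μ tᶜ = 0
    rw [ht, compl_compl, measure_toMeasurable]
    exact mem_ae_iff.1 hs
  refine ⟨f '' (A ∩ t), (hA.inter htm).image_of_measurable_injOn hf
    (hinj.mono (Set.inter_subset_right.trans hts)), ?_⟩
  rw [Filter.eventuallyEq_set]
  filter_upwards [ht0] with x hx
  constructor
  · rintro ⟨x', ⟨hA', ht'⟩, he⟩
    rwa [← hinj (hts ht') (hts hx) he]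
  · exact fun hxA => ⟨x, ⟨hxA, hx⟩, rfl⟩

section Tracking

variable {ι : Type*} {X : Type u} {Y : Type v} [MeasurableSpace X] [MeasurableSpace Y]
  {θ : ι → Y → X} {U : Filter ι} {ν : Measure Y} {μ : Measure X} [IsProbabilityMeasure ν]
  [IsProbabilityMeasure μ]

theorem AsympMeasurePreserving.measurable_of_aeInjective (hθ : AsympMeasurePreserving θ U ν μ)
    {X₁ : Type*} [MeasurableSpace X₁] [StandardBorelSpace X₁] {μ₁ : Measure X₁} {p : X → X₁}
    (hp : MeasurePreserving p μ μ₁) {Z : Type*} [MeasurableSpace Z]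
    [MeasurableSpace.CountablySeparated Z] {f : X₁ → Z} (hf : Measurable f)
    (hinj : PMPAction.AEInjective μ₁ f) {q : X → Z} (hq : Measurable[hθ.limitSpace] q)
    (hfq : ∀ᵐ x ∂μ, f (p x) = q x) : Measurable[hθ.limitSpace] p := by
  intro A hA
  obtain ⟨C, hC, hCA⟩ := hinj.exists_preimage_ae_eq hf hA
  refine hθ.measurableSet_limitSpace_congr (hp.measurable hA) ?_ (hq hC)
  refine EventuallyEq.trans ?_ (hp.quasiMeasurePreserving.preimage_ae_eq hCA)
  rw [Filter.eventuallyEq_set]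
  filter_upwards [hfq] with x hx
  simp [hx]

theorem Tracks.tendsto {A : Set X} {B : Set Y} (h : Tracks θ U ν A B)
    (hθ : ∀ i, Measurable (θ i)) (hA : MeasurableSet A) (hB : MeasurableSet B) :
    Tendsto (fun i => ν.real (θ i ⁻¹' A)) U (𝓝 (ν.real B)) := by
  rw [tendsto_iff_dist_tendsto_zero]
  refine squeeze_zero (fun _ => dist_nonneg) (fun i => ?_) h
  exact abs_measureReal_sub_le_measureReal_symmDiff
    (hθ i hA).nullMeasurableSet hB.nullMeasurableSet

/-- If the preimages of all measurable sets converge, then the limit is a point map. -/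
theorem AsympMeasurePreserving.exists_tracks_preimage [StandardBorelSpace X] [Nonempty X]
    (hθ : AsympMeasurePreserving θ U ν μ) (h : Measurable[hθ.limitSpace] (id : X → X)) :
    ∃ φ : Y → X, Measurable φ ∧ ∀ A, MeasurableSet A → Tracks θ U ν A (φ ⁻¹' A) := by
  classical
  have he : MeasurableEmbedding (MeasurableSpace.mapNatBool X) :=
    MeasurableSpace.measurable_mapNatBool X |>.measurableEmbedding
      (MeasurableSpace.injective_mapNatBool X)
  set e := MeasurableSpace.mapNatBool X
  have hcoord : ∀ k, MeasurableSet {x : ℕ → Bool | x k = true} := fun k =>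
    (measurable_pi_apply k : Measurable fun x : ℕ → Bool => x k) (measurableSet_singleton true)
  choose hm B hB hBtr using fun k => h (he.measurable (hcoord k))
  let φ : Y → ℕ → Bool := fun y k => decide (y ∈ B k)
  have hφ : Measurable φ := measurable_pi_lambda _ fun k => measurable_to_bool (by
    simpa [φ, Set.preimage] using hB k)
  obtain ⟨g, hg, hge⟩ := he.exists_measurable_extend measurable_id fun _ => inferInstance
  have hgφ : Measurable (g ∘ φ) := hg.comp hφ
  let m : MeasurableSpace (ℕ → Bool) :=
    { MeasurableSet' := fun C => MeasurableSet C ∧ Tracks θ U ν (e ⁻¹' C) (φ ⁻¹' C)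
      measurableSet_empty := ⟨.empty, by simp [Tracks, tendsto_const_nhds]⟩
      measurableSet_compl := fun C hC => ⟨hC.1.compl, hC.2.compl⟩
      measurableSet_iUnion := fun C hC => by
        refine ⟨.iUnion fun n => (hC n).1, ?_⟩
        simp only [Set.preimage_iUnion]
        exact hθ.tracks_iUnion (fun n => he.measurable (hC n).1) (fun n => hφ (hC n).1)
          fun n => (hC n).2 }
  have hBk : ∀ k, φ ⁻¹' {x | x k = true} = B k := fun k => by
    ext y
    simp [φ]
  have hid : @Measurable _ _ m MeasurableSpace.pi (id : (ℕ → Bool) → ℕ → Bool) :=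
    @measurable_pi_lambda _ _ _ m _ _ fun k => @measurable_to_bool _ m _ (by
      refine ⟨hcoord k, ?_⟩
      change Tracks θ U ν _ (φ ⁻¹' {x | x k = true})
      rw [hBk]
      exact hBtr k)
  refine ⟨g ∘ φ, hgφ, fun A hA => ?_⟩
  have := (hid (hg hA)).2
  rwa [Set.preimage_id, ← Set.preimage_comp, hge, Set.preimage_id, ← Set.preimage_comp] at this

end Tracking

/-- A compact metrizable space with a continuous action of a compact group carries a compatible
invariant metric. -/
theorem exists_metricSpace_isIsometricSMul (K Z : Type*) [Group K] [TopologicalSpace K]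
    [CompactSpace K] [t : TopologicalSpace Z] [CompactSpace Z]
    [TopologicalSpace.MetrizableSpace Z] [MulAction K Z] [ContinuousSMul K Z] :
    ∃ m : MetricSpace Z, m.toPseudoMetricSpace.toUniformSpace.toTopologicalSpace = t ∧
      ∀ (k : K) (p q : Z), m.dist (k • p) (k • q) = m.dist p q := by
  let := TopologicalSpace.metrizableSpaceMetric Z
  let E : Z → C(K, Z) := fun p => ⟨fun k => k • p, by fun_prop⟩
  have hE : Continuous E := ContinuousMap.continuous_of_continuous_uncurry _ (by
    change Continuous fun x : Z × K => x.2 • x.1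
    fun_prop)
  have hinj : Function.Injective E := fun p q h => by
    simpa [E] using DFunLike.congr_fun h (1 : K)
  have hemb : IsEmbedding E := (hE.isClosedEmbedding hinj).isEmbedding
  refine ⟨hemb.comapMetricSpace E, rfl, ?_⟩
  have hle : ∀ (k : K) (p q : Z), dist (E (k • p)) (E (k • q)) ≤ dist (E p) (E q) := by
    intro k p q
    refine (ContinuousMap.dist_le dist_nonneg).2 fun l => ?_
    have := ContinuousMap.dist_apply_le_dist (f := E p) (g := E q) (l * k)
    simpa [E, mul_smul] using this
  intro k p q
  refine le_antisymm (hle k p q) ?_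
  have h := hle k⁻¹ (k • p) (k • q)
  rw [inv_smul_smul, inv_smul_smul] at h
  exact h

namespace PMPAction

variable {Γ : Type w} [Group Γ] {α : PMPAction.{u} Γ} {β : PMPAction.{v} Γ} {ι : Type*}
  {θ : ι → β → α}

theorem AsympFactorMap.isFactorOf [StandardBorelSpace α] {U : Filter ι} [U.NeBot]
    (hθ : AsympFactorMap β α θ U) (h : Measurable[hθ.limitSpace] (id : α → α)) :
    α.IsFactorOf β := by
  have : Nonempty α := nonempty_of_isProbabilityMeasure α.μ
  obtain ⟨φ, hφ, htr⟩ := hθ.exists_tracks_preimage h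
  have hmp : MeasurePreserving φ β.μ α.μ := by
    refine ⟨hφ, Measure.ext fun A hA => ?_⟩
    rw [Measure.map_apply hφ hA, ← measureReal_eq_measureReal_iff]
    exact tendsto_nhds_unique ((htr A hA).tendsto hθ.measurable hA (hφ hA)) (hθ.tendsto A hA)
  have hset : ∀ (γ : Γ) (A : Set α), MeasurableSet A →
      (fun y => φ (γ • y)) ⁻¹' A =ᵐ[β.μ] (fun y => γ • φ y) ⁻¹' A := by
    intro γ A hA
    have h1 : Tracks (fun i y => θ i (γ • y)) U β.μ A ((fun y => φ (γ • y)) ⁻¹' A) := by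
      refine (htr A hA).congr fun i => ?_
      exact congrArg ENNReal.toReal (measure_preimage_smul β.μ γ _).symm
    have h2 : Tracks (fun i y => γ • θ i y) U β.μ A ((fun y => γ • φ y) ⁻¹' A) :=
      htr ((γ • ·) ⁻¹' A) (measurable_const_smul γ hA)
    exact h1.ae_unique (h2.of_symmDiff (hθ.equivariant γ A hA))
  refine ⟨φ, hmp, fun γ => ?_⟩
  have hcoord : ∀ k, MeasurableSet {x : α | MeasurableSpace.mapNatBool α x k = true} := fun k =>
    (measurable_pi_apply k).comp (MeasurableSpace.measurable_mapNatBool α)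
      (measurableSet_singleton true)
  have hall := ae_all_iff.2 fun k => Filter.eventuallyEq_set.1 (hset γ _ (hcoord k))
  filter_upwards [hall] with y hy
  refine MeasurableSpace.injective_mapNatBool α (funext fun k => ?_)
  exact Bool.eq_iff_iff.2 (hy k)

/-- Suppose that `r` transforms under the action through a cocycle with values in a compact group.
If the preimages of the sets defined by the cocycle converge, then so do those of the sets defined
by `r`. -/
theorem AsympFactorMap.measurable_of_cocycle [Countable Γ] (hβ : β.IsStronglyErgodic)
    {U : Ultrafilter ι} (hθ : AsympFactorMap β α θ U) {K Z : Type*} [Group K]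
    [TopologicalSpace K] [CompactSpace K]
    [TopologicalSpace.MetrizableSpace K] [MeasurableSpace K] [BorelSpace K]
    [TopologicalSpace Z] [CompactSpace Z] [TopologicalSpace.MetrizableSpace Z]
    [MeasurableSpace Z] [BorelSpace Z] [MulAction K Z] [ContinuousSMul K Z]
    {r : α → Z} {w : Γ → α → K} (hr : Measurable r)
    (hw : ∀ γ, Measurable[hθ.limitSpace] (w γ))
    (hrw : ∀ γ : Γ, ∀ᵐ x ∂α.μ, r (γ • x) = w γ x • r x) : Measurable[hθ.limitSpace] r := by
  obtain ⟨m, rfl, hm⟩ := exists_metricSpace_isIsometricSMul K Z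
  let := TopologicalSpace.metrizableSpaceMetric K
  refine hθ.measurable_limitSpace hr ?_
  refine hβ.eventually_dist_lt (R := fun i y => r (θ i y))
    (fun i => hr.comp (hθ.measurable i)) fun γ ε hε => ?_
  have hη : 0 < ε / 5 := by positivity
  have huc : UniformContinuous fun x : K × Z => x.1 • x.2 :=
    CompactSpace.uniformContinuous_of_continuous continuous_smul
  obtain ⟨δ, hδ, hδη⟩ := Metric.uniformContinuous_iff.1 huc (ε / 5) hη
  have hclose : ∀ (k k' : K) (q : Z), dist k k' < δ → dist (k • q) (k' • q) < ε / 5 :=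
    fun k k' q hk => hδη (a := (k, q)) (b := (k', q)) (by
      rw [Prod.dist_eq, dist_self]
      exact max_lt hk hδ)
  have hcoc := (hθ.eventually_dist_lt (hw γ) (lt_min hδ hη)).curry
  have hequiv : ∀ᶠ n in U, β.μ.real
      {y | ε / 5 ≤ dist (r (θ n (γ • y))) (r (γ • θ n y))} < ε / 5 := by
    refine eventually_dist_of_symmDiff (U := (U : Filter ι)) (ν := β.μ)
      (a := fun n y => r (θ n (γ • y))) (b := fun n y => r (γ • θ n y)) (fun E hE => ?_) hη
    exact hθ.equivariant γ (r ⁻¹' E) (hr hE)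
  set N := toMeasurable α.μ {x | ¬ r (γ • x) = w γ x • r x} with hN
  have hN0 : α.μ.real N = 0 := by
    rw [measureReal_eq_zero_iff, hN, measure_toMeasurable]
    exact hrw γ
  have hNlim : ∀ᶠ n in U, β.μ.real (θ n ⁻¹' N) < ε / 5 :=
    (hθ.tendsto N (measurableSet_toMeasurable _ _)).eventually_lt_const (by rwa [hN0])
  filter_upwards [hcoc, hequiv, hNlim] with n hn1 hn2 hn3
  filter_upwards [hn1, hequiv, hNlim] with m hm1 hm2 hm3
  set S₁ : ι → Set β := fun n => {y | ε / 5 ≤ dist (r (θ n (γ • y))) (r (γ • θ n y))}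
  set S₂ : Set β := {y | min δ (ε / 5) ≤ dist (w γ (θ n y)) (w γ (θ m y))}
  have hsub : {y | ε ≤ |dist (r (θ n (γ • y))) (r (θ m (γ • y))) -
      dist (r (θ n y)) (r (θ m y))|} ⊆
      S₂ ∪ ((S₁ n ∪ S₁ m) ∪ (θ n ⁻¹' N ∪ θ m ⁻¹' N)) := by
    intro y hy
    by_contra hcon
    simp only [Set.mem_union, not_or] at hcon
    obtain ⟨h1, ⟨h2, h3⟩, h4, h5⟩ := hcon
    have hnot : ∀ x, x ∉ N → r (γ • x) = w γ x • r x := fun x hx => by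
      by_contra hne
      exact hx (subset_toMeasurable _ _ hne)
    simp only [S₁, S₂, Set.mem_ofPred_eq, not_le] at h1 h2 h3 hy
    rw [hnot _ h4] at h2
    rw [hnot _ h5] at h3
    have h6 := hclose _ _ (r (θ m y)) (h1.trans_le (min_le_left _ _))
    have h7 : dist (w γ (θ n y) • r (θ n y)) (w γ (θ n y) • r (θ m y)) =
      dist (r (θ n y)) (r (θ m y)) := hm _ _ _
    have h8 := dist_dist_dist_le (r (θ n (γ • y))) (r (θ m (γ • y)))
      (w γ (θ n y) • r (θ n y)) (w γ (θ n y) • r (θ m y))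
    have h9 := dist_triangle (r (θ m (γ • y))) (w γ (θ m y) • r (θ m y))
      (w γ (θ n y) • r (θ m y))
    rw [dist_comm (w γ (θ n y) • r (θ m y))] at h6
    rw [h7, Real.dist_eq] at h8
    linarith
  have e1 := (measureReal_mono (μ := β.μ) hsub).trans (measureReal_union_le _ _)
  have e2 := measureReal_union_le (μ := β.μ) (S₁ n ∪ S₁ m) (θ n ⁻¹' N ∪ θ m ⁻¹' N)
  have e3 := measureReal_union_le (μ := β.μ) (S₁ n) (S₁ m)
  have e4 := measureReal_union_le (μ := β.μ) (θ n ⁻¹' N) (θ m ⁻¹' N)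
  have e5 := hm1.trans_le (min_le_right δ (ε / 5))
  linarith

/-- Convergence of preimages passes through compact extensions. -/
theorem AsympFactorMap.measurable_of_isCompactExtension [Countable Γ]
    (hβ : β.IsStronglyErgodic) {U : Ultrafilter ι} (hθ : AsympFactorMap β α θ U)
    {α₀ α₁ : PMPAction.{u} Γ} [StandardBorelSpace α₀] [StandardBorelSpace α₁] {p₀ : α → α₀}
    {p₁ : α → α₁} {φ : α₁ → α₀} (hp₁ : IsFactorMap α α₁ p₁)
    (hφ : IsCompactExtension α₁ α₀ φ) (hcomp : ∀ᵐ x ∂α.μ, φ (p₁ x) = p₀ x)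
    (h : Measurable[hθ.limitSpace] p₀) : Measurable[hθ.limitSpace] p₁ := by
  obtain ⟨-, K, _, _, _, _, _, _, _, L, m, w, Ψ, hL, -, -, hw, -, hΨ, hΨw, hinj, hfst⟩ := hφ
  let := TopologicalSpace.metrizableSpaceMetric K
  have : T2Space (K ⧸ L) := inferInstance
  have : BorelSpace (K ⧸ L) := inferInstance
  have hq := hp₁.measurePreserving.quasiMeasurePreserving
  have hr : Measurable fun x => (Ψ (p₁ x)).2 :=
    hΨ.measurable.snd.comp hp₁.measurePreserving.measurable
  have hrlim : Measurable[hθ.limitSpace] fun x => (Ψ (p₁ x)).2 := by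
    refine hθ.measurable_of_cocycle hβ (w := fun γ x => w γ (p₀ x)) hr
      (fun γ => (hw γ).comp h) fun γ => ?_
    filter_upwards [hp₁.equivariant γ, hq.ae (hΨw γ), hq.ae hfst, hcomp] with x h1 h2 h3 h4
    rw [h1, h2, h3, h4]
  refine hθ.measurable_of_aeInjective hp₁.measurePreserving hΨ.measurable hinj
    (q := fun x => (p₀ x, (Ψ (p₁ x)).2)) (h.prodMk hrlim) ?_
  filter_upwards [hq.ae hfst, hcomp] with x h1 h2
  exact Prod.ext (h1.trans h2) rfl

theorem countable_Iio_of_lt_omega_one {ξ : Ordinal.{0}} (hξ : ξ < ω₁) :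
    Countable (Set.Iio ξ) := by
  rw [← Cardinal.mk_le_aleph0_iff, Cardinal.mk_Iio_ordinal, Cardinal.lift_le_aleph0,
    ← Order.lt_succ_iff, Cardinal.succ_aleph0, ← Cardinal.lt_ord, Cardinal.ord_aleph]
  exact hξ

theorem AsympFactorMap.measurable_proj [Countable Γ] (hβ : β.IsStronglyErgodic)
    {U : Ultrafilter ι} (hθ : AsympFactorMap β α θ U) (T : DistalTower α) {ζ : Ordinal.{0}}
    (hζ : ζ < ω₁) : Measurable[hθ.limitSpace] (T.proj ζ) := by
  induction ζ using Ordinal.limitRecOn with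
  | zero =>
    have := T.zero
    exact @measurable_of_subsingleton_codomain _ _ hθ.limitSpace _ _ _
  | add_one ζ ih =>
    have hζ' : ζ < ω₁ := (Order.lt_succ ζ).trans hζ
    have := T.standard ζ hζ'
    have := T.standard _ hζ
    exact hθ.measurable_of_isCompactExtension hβ (T.isFactorMap_proj _ hζ)
      (T.succ ζ hζ').compact (T.bond_proj _ _ (Order.le_succ ζ) hζ) (ih hζ')
  | limit ξ hξ ih =>
    have := T.standard ξ hζ
    have := countable_Iio_of_lt_omega_one hζ
    have (ζ : Set.Iio ξ) : StandardBorelSpace (T.stage ζ) := T.standard _ (ζ.2.trans hζ)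
    refine hθ.measurable_of_aeInjective (T.isFactorMap_proj ξ hζ).measurePreserving
      (measurable_pi_lambda _ fun ζ : Set.Iio ξ =>
        (T.isFactorMap_bond ζ ξ ζ.2.le hζ).measurePreserving.measurable)
      (T.limit ξ hζ hξ) (q := fun x ζ => T.proj ζ x)
      (@measurable_pi_lambda _ _ _ hθ.limitSpace _ _ fun ζ => ih ζ ζ.2 (ζ.2.trans hζ)) ?_
    filter_upwards [ae_all_iff.2 fun ζ : Set.Iio ξ => T.bond_proj ζ ξ ζ.2.le hζ] with x hx
    exact funext hx

end PMPAction

theorem theorem1p1 {Γ : Type w} [Group Γ] [Countable Γ]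
    (α : PMPAction.{u} Γ) [StandardBorelSpace α] (β : PMPAction.{v} Γ)
    (hβ : β.IsStronglyErgodic) (hαβ : α.WeaklyContained β) :
    (α.IsMeasureDistal → α.IsFactorOf β) ∧ (α.IsCompactAction → α.IsFactorOf β) := by
  obtain ⟨ι, U, θ, hθ⟩ := hαβ.exists_asympFactorMap
  constructor
  · rintro ⟨-, T, ζ, hζ, hinj⟩
    have := T.standard ζ hζ
    have hproj := hθ.measurable_proj hβ T hζ
    exact hθ.isFactorOf (hθ.measurable_of_aeInjective (.id α.μ)
      (T.isFactorMap_proj ζ hζ).measurePreserving.measurable hinj hproj (ae_of_all _ fun _ => rfl))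
  · rintro ⟨-, hα⟩
    have : StandardBorelSpace (PMPAction.point.{u} Γ) :=
      inferInstanceAs (StandardBorelSpace PUnit.{u + 1})
    exact hθ.isFactorOf (hθ.measurable_of_isCompactExtension hβ
      ⟨.id α.μ, fun _ => ae_of_all _ fun _ => rfl⟩ hα (ae_of_all _ fun _ => rfl)
      measurable_const)
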